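/- An OR-, SUM- or XOR-circuit with inputs $x_1,\dots,x_n$ is a finite directed acyclic graph of unbounded fan-in whose arithmetic gates add up their children in the boolean semiring $(\{0,1\},\lor,\land)$, in $(\mathbb{N},+,\cdot)$ or in $\mathrm{GF}(2)$, respectively; its outputs $y_1,\dots,y_m$ are distinct arithmetic gates, a gate without incoming wires computes $0$, and its size is the number of wires. For a matrix $A\in\{0,1\}^{m\times n}$ let $C_{\mathrm{OR}}(A)$, $C_{\mathrm{SUM}}(A)$, $C_{\mathrm{XOR}}(A)$ be the minimum size of a circuit of the respective kind computing $y=Ax$, and let $\mathrm{Gap}_{X/Y}(n)$ be the maximum of $C_X(A)/C_Y(A)$ over all non-zero $A\in\{0,1\}^{n\times n}$. A random matrix $\boldsymbol A$ in $\{0,1\}^{n\times n}$ is $k$-uniform, $k\le n$, if each of its $k\times k$ submatrices is uniformly distributed on $\{0,1\}^{k\times k}$. A sequence of random matrices $\boldsymbol A_n$ in $\{0,1\}^{n\times n}$ is $n^{\Omega(1)}$-uniform if there is $\delta>0$ such that, for all large $n$, $\boldsymbol A_n$ is $k$-uniform for some $k$ with $n^\delta\le k\le n$. Logarithms are to base $2$.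 Then: (1) $\mathrm{Gap}_{\mathrm{OR}/\mathrm{XOR}}(n)=\Omega(n/\log^2 n)$ and $\mathrm{Gap}_{\mathrm{SUM}/\mathrm{XOR}}(n)=\Omega(n/\log^2 n)$. (2) There is an $n^{\Omega(1)}$-uniform sequence $\boldsymbol A_n$ with $C_{\mathrm{XOR}}(\boldsymbol A_n)=O(n)$ (for all outcomes of $\boldsymbol A_n$). Moreover, there is a constant $c>0$ such that every $n^{\Omega(1)}$-uniform sequence $\boldsymbol A_n$ (in particular the one just mentioned) satisfies, with probability tending to $1$ as $n\to\infty$, $$C_{\mathrm{OR}}(\boldsymbol A_n)\ge c\,\frac{n^2}{\log^2 n}\quad\text{and}\quad C_{\mathrm{SUM}}(\boldsymbol A_n)\ge c\,\frac{n^2}{\log^2 n}.$$ -/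

import Mathlib

open Filter Topology

/-- The carrier `{0, 1}` of the boolean semiring `({0,1}, ∨, ∧)`. It is a separate type because
`+` on `Bool` itself is exclusive or. -/
structure BoolSemiring where
  val : Bool

namespace BoolSemiring

/-- Addition is `∨` and multiplication is `∧`. -/
instance : CommSemiring BoolSemiring where
  add a b := ⟨a.val || b.val⟩
  zero := ⟨false⟩
  mul a b := ⟨a.val && b.val⟩
  one := ⟨true⟩
  nsmul n a := ⟨decide (n ≠ 0) && a.val⟩
  add_assoc := by rintro ⟨a⟩ ⟨b⟩ ⟨c⟩; exact congrArg mk (Bool.or_assoc a b c)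
  zero_add := by rintro ⟨a⟩; exact congrArg mk (Bool.false_or a)
  add_zero := by rintro ⟨a⟩; exact congrArg mk (Bool.or_false a)
  add_comm := by rintro ⟨a⟩ ⟨b⟩; exact congrArg mk (Bool.or_comm a b)
  nsmul_zero := by rintro ⟨a⟩; rfl
  nsmul_succ := by rintro (_ | n) ⟨a⟩ <;> cases a <;> rfl
  left_distrib := by rintro ⟨a⟩ ⟨b⟩ ⟨c⟩; exact congrArg mk (Bool.and_or_distrib_left a b c)
  right_distrib := by rintro ⟨a⟩ ⟨b⟩ ⟨c⟩; exact congrArg mk (Bool.and_or_distrib_right a b c)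
  zero_mul := by rintro ⟨a⟩; exact congrArg mk (Bool.false_and a)
  mul_zero := by rintro ⟨a⟩; exact congrArg mk (Bool.and_false a)
  mul_assoc := by rintro ⟨a⟩ ⟨b⟩ ⟨c⟩; exact congrArg mk (Bool.and_assoc a b c)
  one_mul := by rintro ⟨a⟩; exact congrArg mk (Bool.true_and a)
  mul_one := by rintro ⟨a⟩; exact congrArg mk (Bool.and_true a)
  mul_comm := by rintro ⟨a⟩ ⟨b⟩; exact congrArg mk (Bool.and_comm a b)

end BoolSemiring

/-- A circuit of unbounded fan-in with input gates `x_j`, `j : Fin n`, and outputs `y_i`,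
`i : Fin m`: a finite directed acyclic graph, whose arithmetic gates are listed in a topological
order. The outputs are pairwise distinct arithmetic gates. An arithmetic gate without incoming
wires is allowed and computes the empty sum `0` (so that a zero row of a matrix costs nothing). -/
structure LinCircuit (n m : ℕ) where
  /-- the number of arithmetic gates -/
  numGates : ℕ
  /-- the tails of the wires that enter a gate: input gates (`inl`) or arithmetic gates (`inr`) -/
  children : Fin numGates → Finset (Fin n ⊕ Fin numGates)
  /-- wires go forward in the topological order -/
  forward : ∀ g h : Fin numGates, Sum.inr h ∈ children g → h < g
  /-- the gate that computes `y_i` -/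
  out : Fin m ↪ Fin numGates

namespace LinCircuit

/-- The size of a circuit: its number of wires. -/
def size {n m : ℕ} (Γ : LinCircuit n m) : ℕ := ∑ g, (Γ.children g).card

/-- The value of an arithmetic gate on the input `x`: the sum over `R` of the values of its
children. -/
def value {n m : ℕ} (Γ : LinCircuit n m) {R : Type} [CommSemiring R] (x : Fin n → R)
    (g : Fin Γ.numGates) : R :=
  ∑ w ∈ (Γ.children g).attach,
    match w with
    | ⟨Sum.inl j, _⟩ => x j
    | ⟨Sum.inr h, hw⟩ =>
      have := Γ.forward g h hw
      value Γ x h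
termination_by g

theorem value_eq {n m : ℕ} (Γ : LinCircuit n m) {R : Type} [CommSemiring R] (x : Fin n → R)
    (g : Fin Γ.numGates) :
    Γ.value x g = ∑ w ∈ Γ.children g, Sum.elim x (Γ.value x) w := by
  rw [value, ← Finset.sum_attach (Γ.children g)]
  refine Finset.sum_congr rfl ?_
  rintro ⟨j | h, hw⟩ _ <;> rfl

end LinCircuit

/-- The `0/1` matrix over `R` of a boolean matrix. -/
def boolMatrixCast (R : Type) [CommSemiring R] {n m : ℕ} (A : Matrix (Fin m) (Fin n) Bool) :
    Matrix (Fin m) (Fin n) R :=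
  A.map fun b => if b then 1 else 0

/-- The circuit computes `x ↦ A x` in the arithmetic of `R`. -/
def LinCircuit.Computes (R : Type) [CommSemiring R] {n m : ℕ} (Γ : LinCircuit n m)
    (A : Matrix (Fin m) (Fin n) Bool) : Prop :=
  ∀ x : Fin n → R, (fun i => Γ.value x (Γ.out i)) = (boolMatrixCast R A).mulVec x

/-- Every boolean matrix has a circuit (of depth one). -/
theorem LinCircuit.exists_computes (R : Type) [CommSemiring R] {n m : ℕ}
    (A : Matrix (Fin m) (Fin n) Bool) : ∃ Γ : LinCircuit n m, Γ.Computes R A := by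
  refine ⟨⟨m, fun i => (Finset.univ.filter fun j => A i j = true).map Function.Embedding.inl,
    ?_, Function.Embedding.refl _⟩, ?_⟩
  · intro g h hh
    simp at hh
  · intro x
    funext i
    rw [LinCircuit.value_eq]
    simp [boolMatrixCast, Matrix.mulVec, dotProduct, Finset.sum_filter]

/-- The complexity of `A` over `R`: the minimum number of wires of a circuit computing `A`. -/
noncomputable def circuitComplexity (R : Type) [CommSemiring R] {n m : ℕ}
    (A : Matrix (Fin m) (Fin n) Bool) : ℕ :=
  sInf {s : ℕ | ∃ Γ : LinCircuit n m, Γ.Computes R A ∧ Γ.size = s}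

/-- OR-circuits: arithmetic in the boolean semiring. -/
noncomputable abbrev orComplexity {n m : ℕ} (A : Matrix (Fin m) (Fin n) Bool) : ℕ :=
  circuitComplexity BoolSemiring A

/-- SUM-circuits: arithmetic in the semiring of non-negative integers. -/
noncomputable abbrev sumComplexity {n m : ℕ} (A : Matrix (Fin m) (Fin n) Bool) : ℕ :=
  circuitComplexity ℕ A

/-- XOR-circuits: arithmetic in `GF(2)`. -/
noncomputable abbrev xorComplexity {n m : ℕ} (A : Matrix (Fin m) (Fin n) Bool) : ℕ :=
  circuitComplexity (ZMod 2) A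

/-- The maximum over all boolean `n × n` matrices `A` of the ratio of the complexities of `A`
over `R` and over `S`. The zero matrix is the only one of complexity `0`; its ratio `0 / 0 = 0`
does not affect the maximum. -/
noncomputable def complexityGap (R S : Type) [CommSemiring R] [CommSemiring S] (n : ℕ) : ℝ :=
  (Finset.univ : Finset (Matrix (Fin n) (Fin n) Bool)).sup' Finset.univ_nonempty
    fun A => (circuitComplexity R A : ℝ) / (circuitComplexity S A : ℝ)

/-- A random boolean matrix, given by its distribution, is `k`-uniform if each of its `k × k`
submatrices is uniformly distributed. -/
def IsKUniform {n : ℕ} (μ : PMF (Matrix (Fin n) (Fin n) Bool)) (k : ℕ) : Prop :=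
  ∀ r c : Fin k ↪o Fin n,
    μ.map (fun A => A.submatrix r c) = PMF.uniformOfFintype (Matrix (Fin k) (Fin k) Bool)

/-- The random matrices with distributions `μ n` are `n^{Ω(1)}`-uniform: for some `δ > 0` and all
large `n`, the `n`-th one is `k`-uniform for some `k` with `n^δ ≤ k ≤ n`. -/
def IsPolyUniform (μ : ∀ n : ℕ, PMF (Matrix (Fin n) (Fin n) Bool)) : Prop :=
  ∃ δ : ℝ, 0 < δ ∧ ∀ᶠ n : ℕ in atTop, ∃ k : ℕ, (n : ℝ) ^ δ ≤ k ∧ k ≤ n ∧ IsKUniform (μ n) k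

/-! Upper bound. Let `P` be a sparse `n × l` matrix over GF(2), any `k` of whose rows are linearly
independent, and let `R` be a uniformly random `l × l` matrix. Every `k × k` submatrix of `P R Pᵀ`
has the form `P_r R P_cᵀ`, where `P_r` and `P_c` have full row rank. It is the image of `R` under a
surjective linear map, hence uniform. Computing `Pᵀ`, `R` and `P` in three layers costs two wires
per one of `P` and at most `l²` wires for `R`. Such a `P` comes from a random bipartite graph that
is a unique-neighbour expander (`exists_isExpanding`, `IsExpanding.eq_zero_of_vecMul_eq_zero`). It
has constantly many ones per row and `l = O(k⁴)`, so `k ≈ n^(1/8)` gives size `O(n)`.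

Lower bound. An OR-circuit cannot cancel, so for a matrix without all-ones `r × r` submatrix each
wire accounts for fewer than `r²` ones (`LinCircuit.Computes.card_ones_le`). Under `k`-uniformity
with `k ≥ n^δ`, a union bound excludes all-ones `r × r` submatrices for some `r = Θ(log n)`, and
Chebyshev's inequality, which needs only pairwise independence, gives at least `n²/4` ones, both
with high probability. Hence the OR-complexity is `Ω(n²/log² n)`. A SUM-circuit read over the
boolean semiring is an OR-circuit, so the same bound holds for SUM.

For the gaps, an outcome of `P R Pᵀ` that satisfies the lower bound is taken. -/

/-! ### The boolean semiring and change of semiring. -/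

namespace BoolSemiring

theorem eq_zero_or_one (a : BoolSemiring) : a = 0 ∨ a = 1 := by
  rcases a with ⟨_ | _⟩
  · exact Or.inl rfl
  · exact Or.inr rfl

theorem zero_ne_one : (0 : BoolSemiring) ≠ 1 := fun h =>
  Bool.false_ne_true (congrArg BoolSemiring.val h)

theorem add_eq_one_iff (a b : BoolSemiring) : a + b = 1 ↔ a = 1 ∨ b = 1 := by
  have h11 : (1 : BoolSemiring) + 1 = 1 := rfl
  rcases eq_zero_or_one a with rfl | rfl <;> rcases eq_zero_or_one b with rfl | rfl <;>
    simp [zero_ne_one, h11]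

theorem sum_eq_one_iff {ι : Type*} (s : Finset ι) (f : ι → BoolSemiring) :
    ∑ i ∈ s, f i = 1 ↔ ∃ i ∈ s, f i = 1 := by
  classical
  induction s using Finset.induction_on with
  | empty => simp [zero_ne_one]
  | insert a s ha ih => rw [Finset.sum_insert ha, add_eq_one_iff, ih]; simp

theorem natCast_surjective : Function.Surjective (Nat.castRingHom BoolSemiring) := by
  intro a
  rcases eq_zero_or_one a with rfl | rfl
  · exact ⟨0, map_zero _⟩
  · exact ⟨1, map_one _⟩

end BoolSemiring

theorem map_boolMatrixCast {R S : Type} [CommSemiring R] [CommSemiring S] (f : R →+* S) {n m : ℕ}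
    (A : Matrix (Fin m) (Fin n) Bool) : (boolMatrixCast R A).map f = boolMatrixCast S A := by
  ext i j
  simp only [boolMatrixCast, Matrix.map_apply]
  split <;> simp

namespace LinCircuit

theorem map_value {n m : ℕ} (Γ : LinCircuit n m) {R S : Type} [CommSemiring R] [CommSemiring S]
    (f : R →+* S) (x : Fin n → R) (g : Fin Γ.numGates) :
    f (Γ.value x g) = Γ.value (f ∘ x) g := by
  induction g using WellFoundedLT.induction with
  | ind g ih =>
    rw [value_eq, value_eq, map_sum]
    refine Finset.sum_congr rfl ?_
    rintro (j | h) hw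
    · rfl
    · exact ih h (Γ.forward g h hw)

/-- Gate values commute with homomorphisms; surjectivity lifts every input vector over `S` to one
over `R`. -/
theorem Computes.map {n m : ℕ} {Γ : LinCircuit n m} {R S : Type} [CommSemiring R] [CommSemiring S]
    {A : Matrix (Fin m) (Fin n) Bool} (h : Γ.Computes R A) (f : R →+* S)
    (hf : Function.Surjective f) : Γ.Computes S A := by
  intro y
  obtain ⟨x, rfl⟩ := hf.comp_left y
  funext i
  have := congrArg f (congrFun (h x) i)
  rw [map_value, RingHom.map_mulVec, map_boolMatrixCast] at this
  exact this

/-- Without wires every gate computes `0`. -/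
theorem value_eq_zero {n m : ℕ} {Γ : LinCircuit n m} (h : Γ.size = 0) {R : Type} [CommSemiring R]
    (x : Fin n → R) (g : Fin Γ.numGates) : Γ.value x g = 0 := by
  have : Γ.children g = ∅ := by
    simpa using Finset.sum_eq_zero_iff.1 h g (Finset.mem_univ g)
  rw [value_eq, this, Finset.sum_empty]

theorem Computes.apply_out {n m : ℕ} {Γ : LinCircuit n m} {R : Type} [CommSemiring R]
    {A : Matrix (Fin m) (Fin n) Bool} (h : Γ.Computes R A) (i : Fin m) (j : Fin n) :
    Γ.value (Pi.single j (1 : R)) (Γ.out i) = if A i j then 1 else 0 := by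
  have := congrFun (h (Pi.single j (1 : R))) i
  simpa [boolMatrixCast] using this

end LinCircuit

theorem exists_computes_size_eq (R : Type) [CommSemiring R] {n m : ℕ}
    (A : Matrix (Fin m) (Fin n) Bool) :
    ∃ Γ : LinCircuit n m, Γ.Computes R A ∧ Γ.size = circuitComplexity R A := by
  obtain ⟨Γ, hΓ⟩ := LinCircuit.exists_computes R A
  exact Nat.sInf_mem (s := {s : ℕ | ∃ Γ : LinCircuit n m, Γ.Computes R A ∧ Γ.size = s})
    ⟨_, Γ, hΓ, rfl⟩

theorem circuitComplexity_le_size {R : Type} [CommSemiring R] {n m : ℕ}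
    {A : Matrix (Fin m) (Fin n) Bool} {Γ : LinCircuit n m} (h : Γ.Computes R A) :
    circuitComplexity R A ≤ Γ.size :=
  Nat.sInf_le ⟨Γ, h, rfl⟩

/-- The cast from `ℕ` to the boolean semiring is a surjective homomorphism, so an optimal
SUM-circuit also works as an OR-circuit. -/
theorem orComplexity_le_sumComplexity {n m : ℕ} (A : Matrix (Fin m) (Fin n) Bool) :
    orComplexity A ≤ sumComplexity A := by
  obtain ⟨Γ, hΓ, hs⟩ := exists_computes_size_eq ℕ A
  exact (circuitComplexity_le_size
    (hΓ.map (Nat.castRingHom BoolSemiring) BoolSemiring.natCast_surjective)).trans hs.le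

/-- A matrix of complexity `0` over one nontrivial semiring has complexity `0` over any. -/
theorem circuitComplexity_eq_zero_of_eq_zero (R S : Type) [CommSemiring R] [CommSemiring S]
    [Nontrivial S] {n m : ℕ} {A : Matrix (Fin m) (Fin n) Bool} (h : circuitComplexity S A = 0) :
    circuitComplexity R A = 0 := by
  obtain ⟨Γ, hΓ, hs⟩ := exists_computes_size_eq S A
  rw [h] at hs
  have hA : ∀ i j, A i j = false := by
    intro i j
    have := hΓ.apply_out i j
    rw [LinCircuit.value_eq_zero hs] at this
    by_contra hij
    simp [hij] at this
  refine Nat.le_zero.1 ((circuitComplexity_le_size (Γ := Γ) ?_).trans hs.le)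
  intro x
  funext i
  simp [LinCircuit.value_eq_zero hs, boolMatrixCast, Matrix.mulVec, dotProduct, hA]

/-! ### Lower bound for OR-circuits. -/

namespace LinCircuit

variable {n m : ℕ} (Γ : LinCircuit n m)

open Classical in
/-- The inputs on which a node of an OR-circuit depends. -/
noncomputable def inputsOf (w : Fin n ⊕ Fin Γ.numGates) : Finset (Fin n) :=
  Finset.univ.filter fun j =>
    Sum.elim (Pi.single j (1 : BoolSemiring)) (Γ.value (Pi.single j (1 : BoolSemiring))) w = 1

open Classical in
/-- The outputs that are reachable from a gate. -/
noncomputable def outputsOf (g : Fin Γ.numGates) : Finset (Fin m) :=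
  Finset.univ.filter fun i =>
    Relation.ReflTransGen (fun h g => Sum.inr h ∈ Γ.children g) g (Γ.out i)

open Classical in
theorem mem_inputsOf {w : Fin n ⊕ Fin Γ.numGates} {j : Fin n} : j ∈ Γ.inputsOf w ↔
    Sum.elim (Pi.single j (1 : BoolSemiring)) (Γ.value (Pi.single j (1 : BoolSemiring))) w = 1 :=
  Finset.mem_filter.trans (and_iff_right (Finset.mem_univ _))

open Classical in
theorem mem_outputsOf {g : Fin Γ.numGates} {i : Fin m} : i ∈ Γ.outputsOf g ↔
    Relation.ReflTransGen (fun h g => Sum.inr h ∈ Γ.children g) g (Γ.out i) :=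
  Finset.mem_filter.trans (and_iff_right (Finset.mem_univ _))

theorem inputsOf_inl (j : Fin n) : Γ.inputsOf (Sum.inl j) = {j} := by
  ext j'
  by_cases h : j = j'
  · simp [mem_inputsOf, h]
  · simp [mem_inputsOf, h, Ne.symm h, BoolSemiring.zero_ne_one]

theorem mem_inputsOf_inr {g : Fin Γ.numGates} {j : Fin n} :
    j ∈ Γ.inputsOf (Sum.inr g) ↔ ∃ w ∈ Γ.children g, j ∈ Γ.inputsOf w := by
  simp only [mem_inputsOf]
  rw [Sum.elim_inr, value_eq, BoolSemiring.sum_eq_one_iff]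

/-- Disjunctions never cancel, so dependence on an input persists along wires. This is where the
argument fails over GF(2). -/
theorem inputsOf_subset_of_reachable {g h : Fin Γ.numGates}
    (hr : Relation.ReflTransGen (fun h g => Sum.inr h ∈ Γ.children g) g h) :
    Γ.inputsOf (Sum.inr g) ⊆ Γ.inputsOf (Sum.inr h) := by
  induction hr with
  | refl => exact subset_rfl
  | tail _ hbc ih => exact fun j hj => (Γ.mem_inputsOf_inr).2 ⟨_, hbc, ih hj⟩

variable {Γ} in
theorem Computes.mem_inputsOf_out {A : Matrix (Fin m) (Fin n) Bool}
    (h : Γ.Computes BoolSemiring A) {i : Fin m} {j : Fin n} :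
    j ∈ Γ.inputsOf (Sum.inr (Γ.out i)) ↔ A i j = true := by
  rw [mem_inputsOf, Sum.elim_inr, h.apply_out]
  by_cases hA : A i j = true <;> simp [hA, BoolSemiring.zero_ne_one]

/-- A path from an input to a gate that depends on `r` or more inputs contains a wire at which the
number of inputs passes `r`. -/
theorem exists_wire_of_mem_inputsOf {r : ℕ} (hr : 2 ≤ r) {j : Fin n} (g : Fin Γ.numGates)
    (hj : j ∈ Γ.inputsOf (Sum.inr g)) (hg : r ≤ (Γ.inputsOf (Sum.inr g)).card) :
    ∃ h, ∃ w ∈ Γ.children h, j ∈ Γ.inputsOf w ∧ (Γ.inputsOf w).card < r ∧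
      r ≤ (Γ.inputsOf (Sum.inr h)).card ∧
      Relation.ReflTransGen (fun h g => Sum.inr h ∈ Γ.children g) h g := by
  induction g using WellFoundedLT.induction with
  | ind g ih =>
    obtain ⟨w, hw, hjw⟩ := Γ.mem_inputsOf_inr.1 hj
    by_cases hc : (Γ.inputsOf w).card < r
    · exact ⟨g, w, hw, hjw, hc, hg, .refl⟩
    · rw [not_lt] at hc
      rcases w with j' | h
      -- An input node depends on a single input, fewer than `r` because `r ≥ 2`; so the descent
      -- stops before it leaves the arithmetic gates.
      · rw [inputsOf_inl, Finset.card_singleton] at hc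
        omega
      · obtain ⟨h', w', h1, h2, h3, h4, h5⟩ := ih h (Γ.forward g h hw) hjw hc
        exact ⟨h', w', h1, h2, h3, h4, h5.tail hw⟩

variable {Γ} in
/-- An OR-circuit for a matrix without all-ones `r × r` submatrices covers few ones per wire. -/
theorem Computes.card_ones_le {A : Matrix (Fin m) (Fin n) Bool} (h : Γ.Computes BoolSemiring A)
    {r : ℕ} (hr : 2 ≤ r)
    (hfree : ∀ (S : Finset (Fin m)) (T : Finset (Fin n)), S.card = r → T.card = r →
      ∃ i ∈ S, ∃ j ∈ T, A i j = false) :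
    (Finset.univ.filter fun p : Fin m × Fin n => A p.1 p.2 = true).card
      ≤ r ^ 2 * Γ.size + m * r := by
  classical
  -- `U` collects the ones in rows with fewer than `r` ones. `V` collects, for each wire with tail
  -- `e.2` and head `e.1`, the pairs of an output above the head and an input below the tail,
  -- provided both sets are small.
  let U : Finset (Fin m × Fin n) := (Finset.univ : Finset (Fin m)).biUnion fun i =>
    if (Γ.inputsOf (Sum.inr (Γ.out i))).card < r then
      {i} ×ˢ Γ.inputsOf (Sum.inr (Γ.out i)) else ∅
  let V : Finset (Fin m × Fin n) := (Finset.univ.sigma Γ.children).biUnion fun e =>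
    if (Γ.inputsOf e.2).card < r ∧ (Γ.outputsOf e.1).card < r then
      Γ.outputsOf e.1 ×ˢ Γ.inputsOf e.2 else ∅
  have hU : U.card ≤ m * r := by
    have := Finset.card_biUnion_le_card_mul (Finset.univ : Finset (Fin m)) (fun i =>
      if (Γ.inputsOf (Sum.inr (Γ.out i))).card < r then
        ({i} : Finset (Fin m)) ×ˢ Γ.inputsOf (Sum.inr (Γ.out i)) else ∅) r ?_
    · rwa [Finset.card_univ, Fintype.card_fin] at this
    · intro i _
      split_ifs with hi
      · simpa using hi.le
      · simp
  have hV : V.card ≤ Γ.size * r ^ 2 := by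
    have := Finset.card_biUnion_le_card_mul (Finset.univ.sigma Γ.children) (fun e =>
      if (Γ.inputsOf e.2).card < r ∧ (Γ.outputsOf e.1).card < r then
        Γ.outputsOf e.1 ×ˢ Γ.inputsOf e.2 else ∅) (r ^ 2) ?_
    · simpa [size, Finset.card_sigma] using this
    · intro e _
      split_ifs with he
      · rw [Finset.card_product, sq]
        exact Nat.mul_le_mul he.2.le he.1.le
      · simp
  have hsub : (Finset.univ.filter fun p : Fin m × Fin n => A p.1 p.2 = true) ⊆ U ∪ V := by
    rintro ⟨i, j⟩ hp
    have hj : j ∈ Γ.inputsOf (Sum.inr (Γ.out i)) := h.mem_inputsOf_out.2 (by simpa using hp)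
    rw [Finset.mem_union]
    by_cases hi : (Γ.inputsOf (Sum.inr (Γ.out i))).card < r
    · left
      refine Finset.mem_biUnion.2 ⟨i, Finset.mem_univ _, ?_⟩
      simp [hi, hj]
    · right
      obtain ⟨g, w, hw, hjw, hwr, hg, hreach⟩ :=
        Γ.exists_wire_of_mem_inputsOf hr _ hj (not_lt.1 hi)
      -- The head depends on at least `r` inputs, and every output above it inherits them; `r` such
      -- outputs would give an all-ones `r × r` submatrix.
      have hO : (Γ.outputsOf g).card < r := by
        by_contra hO
        obtain ⟨S, hS, hSr⟩ := Finset.exists_subset_card_eq (not_lt.1 hO)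
        obtain ⟨T, hT, hTr⟩ := Finset.exists_subset_card_eq hg
        obtain ⟨i', hi', j', hj', hA⟩ := hfree S T hSr hTr
        have hro := Γ.mem_outputsOf.1 (hS hi')
        have := h.mem_inputsOf_out.1 (Γ.inputsOf_subset_of_reachable hro (hT hj'))
        simp [hA] at this
      refine Finset.mem_biUnion.2 ⟨⟨g, w⟩, by simp [hw], ?_⟩
      simp [hO, hwr, hjw, Γ.mem_outputsOf.2 hreach]
  calc _ ≤ (U ∪ V).card := Finset.card_le_card hsub
    _ ≤ U.card + V.card := Finset.card_union_le _ _
    _ ≤ m * r + Γ.size * r ^ 2 := Nat.add_le_add hU hV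
    _ = _ := by ring

end LinCircuit

theorem card_ones_le_mul_orComplexity {n m r : ℕ} {A : Matrix (Fin m) (Fin n) Bool} (hr : 2 ≤ r)
    (hfree : ∀ (S : Finset (Fin m)) (T : Finset (Fin n)), S.card = r → T.card = r →
      ∃ i ∈ S, ∃ j ∈ T, A i j = false) :
    (Finset.univ.filter fun p : Fin m × Fin n => A p.1 p.2 = true).card
      ≤ r ^ 2 * orComplexity A + m * r := by
  obtain ⟨Γ, hΓ, hs⟩ := exists_computes_size_eq BoolSemiring A
  rw [orComplexity, ← hs]
  exact hΓ.card_ones_le hr hfree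

/-! ### Sparse matrices with independent rows -/

/-- The incidence matrix of the bipartite graph that joins `i` to `(t, F t i)`, for all `t`. -/
def incidenceMatrix {d n q : ℕ} (F : Fin d → Fin n → Fin q) :
    Matrix (Fin n) (Fin d × Fin q) (ZMod 2) :=
  Matrix.of fun i p => if F p.1 i = p.2 then 1 else 0

/-- Every small set `S` has more than `|S| / 2` neighbours in one of the `d` blocks. -/
def IsExpanding {d n q : ℕ} (F : Fin d → Fin n → Fin q) (k : ℕ) : Prop :=
  ∀ S : Finset (Fin n), S.Nonempty → S.card ≤ k → ∃ t, S.card / 2 < (S.image (F t)).card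

/-- For random `f` the image of `S` is this small with probability at most `k^(-|S|)`. With `h =
|S|/2` rounded down, such an `f` is determined by `h` values, a map from `S` to `Fin h` and the
values off `S`. As `4h ≤ 2|S|`, a range of size `k⁴` pays for the `h^|S| ≤ k^|S|` maps and leaves a
factor `k^|S|`. -/
theorem card_filter_card_image_le {n k : ℕ} (hk : 0 < k) (S : Finset (Fin n))
    (hS : S.card ≤ k) :
    (Finset.univ.filter fun f : Fin n → Fin (k ^ 4) =>
      (S.image f).card ≤ S.card / 2).card * k ^ S.card ≤ (k ^ 4) ^ n := by
  classical
  set h := S.card / 2 with hh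
  let Φ : (Fin h → Fin (k ^ 4)) × (S → Fin h) × ({i // i ∉ S} → Fin (k ^ 4)) →
      (Fin n → Fin (k ^ 4)) := fun x i =>
    if hi : i ∈ S then x.1 (x.2.1 ⟨i, hi⟩) else x.2.2 ⟨i, hi⟩
  have hsub : (Finset.univ.filter fun f : Fin n → Fin (k ^ 4) => (S.image f).card ≤ h) ⊆
      Finset.univ.image Φ := by
    intro f hf
    have hf : (S.image f).card ≤ h := (Finset.mem_filter.1 hf).2
    rw [Finset.mem_image]
    let e := (S.image f).equivFin
    let u : S → Fin h := fun i =>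
      Fin.castLE hf (e ⟨f i, Finset.mem_image_of_mem f i.2⟩)
    -- The image may have fewer than `h` elements; the remaining slots get the dummy value `0`,
    -- which is never read.
    let g : Fin h → Fin (k ^ 4) := fun a =>
      if ha : a.1 < (S.image f).card then (e.symm ⟨a.1, ha⟩).1 else ⟨0, by positivity⟩
    refine ⟨(g, u, fun i => f i), Finset.mem_univ _, ?_⟩
    funext i
    by_cases hi : i ∈ S
    · simp [Φ, hi, g, u]
    · simp [Φ, hi]
  have hcard : (Finset.univ.filter fun f : Fin n → Fin (k ^ 4) => (S.image f).card ≤ h).card ≤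
      (k ^ 4) ^ h * (h ^ S.card * (k ^ 4) ^ (n - S.card)) := by
    refine (Finset.card_le_card hsub).trans (Finset.card_image_le.trans (le_of_eq ?_))
    simp [Fintype.card_subtype_compl]
  have hSn : S.card ≤ n := by simpa using Finset.card_le_univ S
  calc _ ≤ (k ^ 4) ^ h * (k ^ S.card * (k ^ 4) ^ (n - S.card)) * k ^ S.card := by
        refine Nat.mul_le_mul_right _ (hcard.trans ?_)
        gcongr
        omega
    _ = k ^ (4 * h + S.card + 4 * (n - S.card) + S.card) := by
        simp only [← pow_mul, ← pow_add]
        congr 1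
        ring
    _ ≤ k ^ (4 * n) := Nat.pow_le_pow_right hk (by omega)
    _ = _ := by rw [pow_mul]

/-- Union bound: a fixed `S` of size `s` is bad in all `d` independent blocks with probability at
most `k^(-ds)`, and there are at most `n^s` such sets. Since `n < k^d / k`, each size `s ≥ 1`
contributes less than `1/k`, and there are `k` sizes. -/
theorem exists_isExpanding {n k d : ℕ} (hk : 0 < k) (hnk : n * k < k ^ d) :
    ∃ F : Fin d → Fin n → Fin (k ^ 4), IsExpanding F k := by
  classical
  by_contra! hF
  let B : Finset (Fin n) → Finset (Fin n → Fin (k ^ 4)) := fun S =>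
    Finset.univ.filter fun f => (S.image f).card ≤ S.card / 2
  have hcover : (Finset.univ : Finset (Fin d → Fin n → Fin (k ^ 4))) ⊆
      (Finset.Icc 1 k).biUnion fun s => (Finset.powersetCard s Finset.univ).biUnion fun S =>
        Fintype.piFinset fun _ : Fin d => B S := by
    intro F _
    have := hF F
    simp only [IsExpanding] at this
    push Not at this
    obtain ⟨S, hS, hSk, hb⟩ := this
    refine Finset.mem_biUnion.2 ⟨S.card, Finset.mem_Icc.2 ⟨hS.card_pos, hSk⟩, ?_⟩
    refine Finset.mem_biUnion.2 ⟨S, by simp, ?_⟩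
    simpa [B] using hb
  set N : ℕ := ((k ^ 4) ^ n) ^ d with hN
  have hNpos : 0 < N := by positivity
  have hkR : (0 : ℝ) < k := by exact_mod_cast hk
  have hlevel : ∀ s ∈ Finset.Icc 1 k, (((Finset.powersetCard s Finset.univ).biUnion fun S =>
        Fintype.piFinset fun _ : Fin d => B S).card : ℝ) < N / k := by
    intro s hs
    rw [Finset.mem_Icc] at hs
    have h1 : ((Finset.powersetCard s Finset.univ).biUnion fun S =>
        Fintype.piFinset fun _ : Fin d => B S).card * (k ^ d) ^ s ≤ n ^ s * N := by
      calc _ ≤ (∑ S ∈ Finset.powersetCard s Finset.univ, (B S).card ^ d) * (k ^ d) ^ s := by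
            refine Nat.mul_le_mul_right _ (Finset.card_biUnion_le.trans (le_of_eq ?_))
            simp
        _ = ∑ S ∈ Finset.powersetCard s Finset.univ, ((B S).card * k ^ s) ^ d := by
            rw [Finset.sum_mul]
            refine Finset.sum_congr rfl fun S _ => ?_
            rw [mul_pow, ← pow_mul, ← pow_mul, mul_comm d s]
        _ ≤ ∑ _S ∈ Finset.powersetCard s (Finset.univ : Finset (Fin n)), N := by
            refine Finset.sum_le_sum fun S hS => Nat.pow_le_pow_left ?_ d
            have hSs := (Finset.mem_powersetCard.1 hS).2
            rw [← hSs]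
            exact card_filter_card_image_le hk S (hSs ▸ hs.2)
        _ ≤ n ^ s * N := by
            rw [Finset.sum_const, Finset.card_powersetCard, smul_eq_mul, Finset.card_univ,
              Fintype.card_fin]
            exact Nat.mul_le_mul_right _ (Nat.choose_le_pow _ _)
    have h2 : (n * k) ^ s < (k ^ d) ^ s := Nat.pow_lt_pow_left hnk (by omega)
    rw [lt_div_iff₀ hkR]
    have h3 : ((Finset.powersetCard s Finset.univ).biUnion fun S =>
        Fintype.piFinset fun _ : Fin d => B S).card * k < N := by
      by_contra! hcon
      have h4 : N * (k ^ d) ^ s ≤ N * (n * k) ^ s := by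
        calc N * (k ^ d) ^ s ≤ _ := Nat.mul_le_mul_right _ hcon
          _ = (((Finset.powersetCard s Finset.univ).biUnion fun S =>
              Fintype.piFinset fun _ : Fin d => B S).card * (k ^ d) ^ s) * k := by ring
          _ ≤ n ^ s * N * k := Nat.mul_le_mul_right _ h1
          _ ≤ n ^ s * N * k ^ s :=
            Nat.mul_le_mul_left _ (Nat.le_self_pow (by omega) k)
          _ = _ := by rw [mul_pow]; ring
      exact absurd (Nat.le_of_mul_le_mul_left h4 hNpos) (not_le.2 h2)
    exact_mod_cast h3
  have htotal : (N : ℝ) < N := by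
    calc (N : ℝ) = ((Finset.univ : Finset (Fin d → Fin n → Fin (k ^ 4))).card : ℝ) := by
          simp [hN]
      _ ≤ ∑ s ∈ Finset.Icc 1 k, (((Finset.powersetCard s Finset.univ).biUnion fun S =>
          Fintype.piFinset fun _ : Fin d => B S).card : ℝ) := by
          exact_mod_cast (Finset.card_le_card hcover).trans Finset.card_biUnion_le
      _ < ∑ _s ∈ Finset.Icc 1 k, (N : ℝ) / k :=
          Finset.sum_lt_sum_of_nonempty (Finset.nonempty_Icc.2 hk) hlevel
      _ = N := by
          rw [Finset.sum_const, Nat.card_Icc, nsmul_eq_mul, Nat.add_sub_cancel]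
          field_simp
  exact lt_irrefl _ htotal

/-- Unique neighbours: in some block the rows in the support of `v` have more than half as many
neighbours as there are rows, so some column meets exactly one of these rows, and there `v` times
the matrix does not vanish. -/
theorem IsExpanding.eq_zero_of_vecMul_eq_zero {d n q k : ℕ} {F : Fin d → Fin n → Fin q}
    (hF : IsExpanding F k) {r : Fin k → Fin n} (hr : Function.Injective r) {v : Fin k → ZMod 2}
    (hv : Matrix.vecMul v ((incidenceMatrix F).submatrix r id) = 0) : v = 0 := by
  classical
  by_contra hne
  obtain ⟨i₀, hi₀⟩ := Function.ne_iff.1 hne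
  let V : Finset (Fin k) := Finset.univ.filter fun i => v i ≠ 0
  obtain ⟨t, ht⟩ := hF (V.image r) ⟨r i₀, Finset.mem_image_of_mem r (by simpa [V] using hi₀)⟩
    (Finset.card_image_le.trans (by simpa using Finset.card_le_univ V))
  rw [Finset.image_image, Finset.card_image_of_injective _ hr] at ht
  -- If all fibres over the image had two or more elements, the image would have at most `|V|/2`.
  obtain ⟨a, ha, ha2⟩ : ∃ a ∈ V.image (F t ∘ r), (V.filter fun i => (F t ∘ r) i = a).card < 2 := by
    by_contra! hcon
    have := Finset.mul_card_image_le_card V 2 hcon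
    omega
  obtain ⟨i, hi, rfl⟩ := Finset.mem_image.1 ha
  have hsingle : ∀ j ∈ V, F t (r j) = F t (r i) → j = i := by
    intro j hj hji
    exact Finset.card_le_one.1 (Nat.lt_succ_iff.1 ha2) j (Finset.mem_filter.2 ⟨hj, hji⟩) i
      (Finset.mem_filter.2 ⟨hi, rfl⟩)
  have hsum := congrFun hv (t, F t (r i))
  simp only [Matrix.vecMul, dotProduct, incidenceMatrix, Matrix.submatrix_apply, Matrix.of_apply,
    id, Pi.zero_apply] at hsum
  rw [Finset.sum_eq_single i] at hsum
  · exact (Finset.mem_filter.1 hi).2 (by simpa using hsum)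
  · intro j _ hji
    by_cases hj : j ∈ V
    · rw [if_neg fun h => hji (hsingle j hj h), mul_zero]
    · rw [show v j = 0 by simpa [V] using hj, zero_mul]
  · exact fun h => absurd (Finset.mem_univ i) h

theorem Matrix.exists_mul_eq_one_of_vecMul {K m l : Type*} [Field K] [Fintype m] [DecidableEq m]
    [Fintype l] [DecidableEq l] (P : Matrix m l K) (h : ∀ v, Matrix.vecMul v P = 0 → v = 0) :
    ∃ B : Matrix l m K, P * B = 1 := by
  obtain ⟨g, hg⟩ := (Matrix.toLin' P.transpose).exists_leftInverse_of_injective (by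
    rw [LinearMap.ker_eq_bot']
    intro v hv
    exact h v (by simpa [Matrix.mulVec_transpose] using hv))
  refine ⟨(LinearMap.toMatrix' g).transpose, ?_⟩
  have := congrArg LinearMap.toMatrix' hg
  rw [LinearMap.toMatrix'_comp, LinearMap.toMatrix'_toLin', LinearMap.toMatrix'_id] at this
  rw [← Matrix.transpose_inj, Matrix.transpose_mul, Matrix.transpose_transpose, this,
    Matrix.transpose_one]

/-! ### Layered circuits -/

namespace LinCircuit

/-- The circuit of depth one with prescribed summands. -/
def ofSummands {n m : ℕ} (L : Fin m → Finset (Fin n)) : LinCircuit n m where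
  numGates := m
  children i := (L i).map Function.Embedding.inl
  forward := by simp
  out := Function.Embedding.refl _

/-- Adds a layer of gates that sum up the outputs of a circuit. -/
def addLayer {n l m : ℕ} (Γ : LinCircuit n l) (L : Fin m → Finset (Fin l)) : LinCircuit n m where
  numGates := Γ.numGates + m
  children := Fin.append
    (fun g => (Γ.children g).map ((Function.Embedding.refl _).sumMap (Fin.castAddEmb m)))
    (fun i => (L i).map ((Γ.out.trans (Fin.castAddEmb m)).trans Function.Embedding.inr))
  forward g h := by
    refine Fin.addCases (fun g => ?_) (fun i => ?_) g
    · rw [Fin.append_left, Finset.mem_map]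
      rintro ⟨j | h', hw, hh⟩
      · simp at hh
      · obtain rfl : Fin.castAdd m h' = h := by simpa using hh
        exact Γ.forward g h' hw
    · rw [Fin.append_right, Finset.mem_map]
      rintro ⟨p, _, hh⟩
      obtain rfl : Fin.castAdd m (Γ.out p) = h := by simpa using hh
      exact Fin.lt_def.2 (by simp; omega)
  out := Fin.natAddEmb Γ.numGates

/-- The gates of the original circuit. -/
def oldGate {n l m : ℕ} (Γ : LinCircuit n l) (L : Fin m → Finset (Fin l)) :
    Fin Γ.numGates ↪ Fin (Γ.addLayer L).numGates :=
  Fin.castAddEmb m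

theorem children_oldGate {n l m : ℕ} (Γ : LinCircuit n l) (L : Fin m → Finset (Fin l))
    (g : Fin Γ.numGates) : (Γ.addLayer L).children (Γ.oldGate L g) =
      (Γ.children g).map ((Function.Embedding.refl _).sumMap (Γ.oldGate L)) :=
  Fin.append_left
    (fun g => (Γ.children g).map ((Function.Embedding.refl _).sumMap (Fin.castAddEmb m)))
    (fun i => (L i).map ((Γ.out.trans (Fin.castAddEmb m)).trans Function.Embedding.inr)) g

theorem children_addLayer_out {n l m : ℕ} (Γ : LinCircuit n l) (L : Fin m → Finset (Fin l))
    (i : Fin m) : (Γ.addLayer L).children ((Γ.addLayer L).out i) =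
      (L i).map ((Γ.out.trans (Γ.oldGate L)).trans Function.Embedding.inr) :=
  Fin.append_right
    (fun g => (Γ.children g).map ((Function.Embedding.refl _).sumMap (Fin.castAddEmb m)))
    (fun i => (L i).map ((Γ.out.trans (Fin.castAddEmb m)).trans Function.Embedding.inr)) i

theorem size_addLayer {n l m : ℕ} (Γ : LinCircuit n l) (L : Fin m → Finset (Fin l)) :
    (Γ.addLayer L).size = Γ.size + ∑ i, (L i).card := by
  have h : (Γ.addLayer L).size = ∑ g, ((Γ.addLayer L).children (Γ.oldGate L g)).card +
      ∑ i, ((Γ.addLayer L).children ((Γ.addLayer L).out i)).card :=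
    Fin.sum_univ_add fun g : Fin (Γ.numGates + m) => ((Γ.addLayer L).children g).card
  simp only [h, children_oldGate, children_addLayer_out, Finset.card_map]
  rfl

theorem value_oldGate {n l m : ℕ} (Γ : LinCircuit n l) (L : Fin m → Finset (Fin l))
    {R : Type} [CommSemiring R] (x : Fin n → R) (g : Fin Γ.numGates) :
    (Γ.addLayer L).value x (Γ.oldGate L g) = Γ.value x g := by
  induction g using WellFoundedLT.induction with
  | ind g ih =>
    rw [value_eq, value_eq, children_oldGate, Finset.sum_map]
    refine Finset.sum_congr rfl ?_
    rintro (j | h) hw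
    · rfl
    · exact ih h (Γ.forward g h hw)

theorem value_addLayer_out {n l m : ℕ} (Γ : LinCircuit n l) (L : Fin m → Finset (Fin l))
    {R : Type} [CommSemiring R] (x : Fin n → R) (i : Fin m) :
    (Γ.addLayer L).value x ((Γ.addLayer L).out i) = ∑ p ∈ L i, Γ.value x (Γ.out p) := by
  rw [value_eq, children_addLayer_out, Finset.sum_map]
  exact Finset.sum_congr rfl fun p _ => Γ.value_oldGate L x (Γ.out p)

end LinCircuit

/-- The positions of the ones of a row of a matrix over `GF(2)`. -/
def rowSupport {m n : ℕ} (M : Matrix (Fin m) (Fin n) (ZMod 2)) (i : Fin m) : Finset (Fin n) :=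
  Finset.univ.filter fun j => M i j = 1

theorem sum_rowSupport {m n : ℕ} (M : Matrix (Fin m) (Fin n) (ZMod 2)) (i : Fin m)
    (y : Fin n → ZMod 2) : ∑ j ∈ rowSupport M i, y j = M.mulVec y i := by
  have h01 : ∀ a b : ZMod 2, (if a = 1 then b else (0 : ZMod 2)) = a * b := by decide
  simp only [rowSupport, Finset.sum_filter, h01, Matrix.mulVec, dotProduct]

theorem sum_card_rowSupport_transpose {m n : ℕ} (M : Matrix (Fin m) (Fin n) (ZMod 2)) :
    ∑ j, (rowSupport M.transpose j).card = ∑ i, (rowSupport M i).card := by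
  simp only [rowSupport, Finset.card_filter]
  exact Finset.sum_comm

/-- Circuits for a product of three matrices. -/
theorem xorComplexity_le_of_eq_mul {m l l' n : ℕ} {A : Matrix (Fin m) (Fin n) Bool}
    (M : Matrix (Fin m) (Fin l) (ZMod 2)) (N : Matrix (Fin l) (Fin l') (ZMod 2))
    (K : Matrix (Fin l') (Fin n) (ZMod 2)) (h : boolMatrixCast (ZMod 2) A = M * N * K) :
    xorComplexity A ≤ ∑ i, (rowSupport K i).card + ∑ i, (rowSupport N i).card +
      ∑ i, (rowSupport M i).card := by
  let Γ : LinCircuit n m := ((LinCircuit.ofSummands (rowSupport K)).addLayer (rowSupport N)).addLayer (rowSupport M)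
  have hsize : Γ.size = ∑ i, (rowSupport K i).card + ∑ i, (rowSupport N i).card +
      ∑ i, (rowSupport M i).card := by
    rw [LinCircuit.size_addLayer, LinCircuit.size_addLayer]
    simp only [LinCircuit.size, LinCircuit.ofSummands, Finset.card_map]
    rfl
  refine (circuitComplexity_le_size (Γ := Γ) fun x => ?_).trans hsize.le
  have hK : ∀ i, (LinCircuit.ofSummands (rowSupport K)).value x
      ((LinCircuit.ofSummands (rowSupport K)).out i) = K.mulVec x i := by
    intro i
    rw [LinCircuit.value_eq, ← sum_rowSupport]
    simp only [LinCircuit.ofSummands, Finset.sum_map]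
    rfl
  funext i
  simp only [Γ, LinCircuit.value_addLayer_out, hK, sum_rowSupport]
  rw [h, ← Matrix.mulVec_mulVec, ← Matrix.mulVec_mulVec]

/-- The incidence matrix of an expander has a single one per row and block. Independence of rows is
stated through a right inverse, from which preimages under `R ↦ P_r R P_cᵀ` are built. -/
theorem exists_sparse_independent_rows {n k d : ℕ} (hk : 0 < k) (hnk : n * k < k ^ d) :
    ∃ P : Matrix (Fin n) (Fin (d * k ^ 4)) (ZMod 2), (∀ i, (rowSupport P i).card ≤ d) ∧
      ∀ r : Fin k → Fin n, Function.Injective r → ∃ B : Matrix (Fin (d * k ^ 4)) (Fin k) (ZMod 2),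
        P.submatrix r id * B = 1 := by
  classical
  obtain ⟨F, hF⟩ := exists_isExpanding hk hnk
  refine ⟨(incidenceMatrix F).submatrix id finProdFinEquiv.symm, fun i => ?_, fun r hr => ?_⟩
  · have : rowSupport ((incidenceMatrix F).submatrix id finProdFinEquiv.symm) i ⊆
        Finset.univ.image fun t : Fin d => finProdFinEquiv (t, F t i) := by
      intro p hp
      obtain ⟨⟨t, a⟩, rfl⟩ := finProdFinEquiv.surjective p
      have ha : F t i = a := by
        have := (Finset.mem_filter.1 hp).2
        rw [Matrix.submatrix_apply, Equiv.symm_apply_apply] at this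
        by_contra ha
        simp [incidenceMatrix, ha] at this
      exact Finset.mem_image.2 ⟨t, Finset.mem_univ t, by rw [ha]⟩
    exact (Finset.card_le_card this).trans (Finset.card_image_le.trans (by simp))
  · refine Matrix.exists_mul_eq_one_of_vecMul _ fun v hv => hF.eq_zero_of_vecMul_eq_zero hr ?_
    funext p
    have := congrFun hv (finProdFinEquiv p)
    simpa [Matrix.vecMul, dotProduct, -finProdFinEquiv_symm_apply] using this

/-! ### Uniform distributions -/

theorem PMF.eq_uniformOfFintype {α : Type*} [Fintype α] [Nonempty α] (p : PMF α)
    (h : ∀ a b, p a = p b) : p = PMF.uniformOfFintype α := by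
  ext a
  have h1 := p.tsum_coe
  rw [tsum_fintype, Finset.sum_congr rfl fun b _ => h b a, Finset.sum_const, nsmul_eq_mul,
    Finset.card_univ] at h1
  rw [PMF.uniformOfFintype_apply]
  exact ENNReal.eq_inv_of_mul_eq_one_left (by rw [mul_comm]; exact h1)

/-- The fibres are translates of one another, hence equally likely. -/
theorem PMF.map_uniformOfFintype_of_surjective {G H : Type*} [AddGroup G] [AddGroup H] [Fintype G]
    [Fintype H] (f : G →+ H) (hf : Function.Surjective f) :
    (PMF.uniformOfFintype G).map f = PMF.uniformOfFintype H := by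
  classical
  refine PMF.eq_uniformOfFintype _ fun a b => ?_
  obtain ⟨g, hg⟩ := hf (-a + b)
  rw [PMF.map_apply, PMF.map_apply, ← (Equiv.addRight g).tsum_eq fun x =>
    if b = f x then PMF.uniformOfFintype G x else 0]
  refine tsum_congr fun x => ?_
  have : b = f x + f g ↔ a = f x := by
    rw [hg, ← add_assoc, eq_comm, add_eq_right, add_neg_eq_zero, eq_comm]
  simp [this]

theorem PMF.map_uniformOfFintype_equiv {α β : Type*} [Fintype α] [Nonempty α] [Fintype β]
    [Nonempty β] (e : α ≃ β) : (PMF.uniformOfFintype α).map e = PMF.uniformOfFintype β := by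
  classical
  refine PMF.eq_uniformOfFintype _ fun a b => ?_
  have : ∀ c, (PMF.uniformOfFintype α).map e c = (Fintype.card α : ENNReal)⁻¹ := by
    intro c
    rw [PMF.map_apply, tsum_eq_single (e.symm c)]
    · simp
    · intro x hx
      rw [if_neg]
      rintro rfl
      simp at hx
  rw [this, this]

/-- The elements of `GF(2)` as bits. -/
def zmodTwoEquivBool : ZMod 2 ≃ Bool where
  toFun a := decide (a = 1)
  invFun b := if b then 1 else 0
  left_inv := by decide
  right_inv := by decide

/-! ### Uniform random matrices of linear XOR-complexity. -/

theorem boolMatrixCast_map_zmodTwoEquivBool {n m : ℕ} (M : Matrix (Fin m) (Fin n) (ZMod 2)) :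
    boolMatrixCast (ZMod 2) (M.map zmodTwoEquivBool) = M := by
  ext i j
  exact zmodTwoEquivBool.left_inv (M i j)

/-- The boolean matrix `P R Pᵀ` for a uniformly random matrix `R` over `GF(2)`. -/
noncomputable def sandwichPMF {n l : ℕ} (P : Matrix (Fin n) (Fin l) (ZMod 2)) :
    PMF (Matrix (Fin n) (Fin n) Bool) :=
  (PMF.uniformOfFintype (Matrix (Fin l) (Fin l) (ZMod 2))).map fun R =>
    (P * R * P.transpose).map zmodTwoEquivBool

/-- With right inverses `B` and `C` of the selected rows, `B M Cᵀ` is a preimage of `M` under `R ↦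
P_r R P_cᵀ`; a surjective homomorphism preserves uniformity. -/
theorem isKUniform_sandwichPMF {n l k : ℕ} (P : Matrix (Fin n) (Fin l) (ZMod 2))
    (hP : ∀ r : Fin k → Fin n, Function.Injective r → ∃ B : Matrix (Fin l) (Fin k) (ZMod 2), P.submatrix r id * B = 1) :
    IsKUniform (sandwichPMF P) k := by
  intro r c
  obtain ⟨B, hB⟩ := hP r r.injective
  obtain ⟨C, hC⟩ := hP c c.injective
  let f : Matrix (Fin l) (Fin l) (ZMod 2) →+ Matrix (Fin k) (Fin k) (ZMod 2) :=
    { toFun := fun R => P.submatrix r id * R * (P.submatrix c id).transpose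
      map_zero' := by simp
      map_add' := fun R S => by rw [Matrix.mul_add, Matrix.add_mul] }
  have hf : Function.Surjective f := by
    intro M
    refine ⟨B * M * C.transpose, ?_⟩
    change P.submatrix r id * (B * M * C.transpose) * (P.submatrix c id).transpose = M
    have hC' : C.transpose * (P.submatrix c id).transpose = 1 := by
      rw [← Matrix.transpose_mul, hC, Matrix.transpose_one]
    calc _ = (P.submatrix r id * B) * M * (C.transpose * (P.submatrix c id).transpose) := by
          simp only [Matrix.mul_assoc]
      _ = M := by rw [hB, hC', Matrix.one_mul, Matrix.mul_one]
  let e : Matrix (Fin k) (Fin k) (ZMod 2) ≃ Matrix (Fin k) (Fin k) Bool :=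
    zmodTwoEquivBool.mapMatrix
  have hcomp : (fun A : Matrix (Fin n) (Fin n) Bool => A.submatrix r c) ∘
      (fun R => (P * R * P.transpose).map zmodTwoEquivBool) = e ∘ f := by
    funext R
    ext i j
    simp [e, f, Matrix.mul_apply]
  rw [sandwichPMF, PMF.map_comp, hcomp, ← PMF.map_comp, PMF.map_uniformOfFintype_of_surjective f hf,
    PMF.map_uniformOfFintype_equiv]

theorem xorComplexity_le_of_mem_support_sandwichPMF {n l d : ℕ}
    {P : Matrix (Fin n) (Fin l) (ZMod 2)} (hP : ∀ i, (rowSupport P i).card ≤ d)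
    {A : Matrix (Fin n) (Fin n) Bool} (hA : A ∈ (sandwichPMF P).support) :
    xorComplexity A ≤ 2 * (n * d) + l ^ 2 := by
  rw [sandwichPMF, PMF.mem_support_map_iff] at hA
  obtain ⟨R, _, rfl⟩ := hA
  have h1 : ∑ i, (rowSupport P i).card ≤ n * d := by
    simpa using Finset.sum_le_card_nsmul Finset.univ _ d fun i _ => hP i
  have h2 : ∑ i, (rowSupport R i).card ≤ l ^ 2 := by
    have := Finset.sum_le_card_nsmul Finset.univ (fun i => (rowSupport R i).card) l fun i _ => by
      simpa using Finset.card_le_univ (rowSupport R i)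
    simpa [sq] using this
  have := xorComplexity_le_of_eq_mul P R P.transpose (boolMatrixCast_map_zmodTwoEquivBool _)
  rw [sum_card_rowSupport_transpose] at this
  omega

/-- Take `k = ⌊n^(1/8)⌋`, so that `l² = (17k⁴)² ≤ 289n`. The hypothesis `n ≥ 2⁸` gives `k ≥ 2`,
hence `k + 1 ≤ k²` and `n < k¹⁶`: this yields the exponent `1/16` and allows `d = 17`. In total `323
= 2 · 17 + 289`. -/
theorem exists_isKUniform_xorComplexity_le {n : ℕ} (hn : 256 ≤ n) :
    ∃ μ : PMF (Matrix (Fin n) (Fin n) Bool),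
      (∃ k : ℕ, (n : ℝ) ^ (1 / 16 : ℝ) ≤ k ∧ k ≤ n ∧ IsKUniform μ k) ∧
      ∀ A ∈ μ.support, (xorComplexity A : ℝ) ≤ 323 * n := by
  obtain ⟨k, hkn, hnk⟩ : ∃ k, k ^ 8 ≤ n ∧ n < (k + 1) ^ 8 := by
    refine ⟨n.sqrt.sqrt.sqrt, ?_, ?_⟩
    · calc n.sqrt.sqrt.sqrt ^ 8 = ((n.sqrt.sqrt.sqrt ^ 2) ^ 2) ^ 2 := by ring
        _ ≤ (n.sqrt.sqrt ^ 2) ^ 2 := by gcongr; exact Nat.sqrt_le' _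
        _ ≤ n.sqrt ^ 2 := by gcongr; exact Nat.sqrt_le' _
        _ ≤ n := Nat.sqrt_le' _
    · have h3 := Nat.succ_le_succ_sqrt' n
      have h2 := Nat.succ_le_succ_sqrt' n.sqrt
      have h1 := Nat.succ_le_succ_sqrt' n.sqrt.sqrt
      calc n < n + 1 := Nat.lt_succ_self n
        _ ≤ (n.sqrt + 1) ^ 2 := h3
        _ ≤ ((n.sqrt.sqrt + 1) ^ 2) ^ 2 := by gcongr
        _ ≤ (((n.sqrt.sqrt.sqrt + 1) ^ 2) ^ 2) ^ 2 := by gcongr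
        _ = _ := by ring
  have hk2 : 2 ≤ k := by
    by_contra! h
    have : (k + 1) ^ 8 ≤ 2 ^ 8 := Nat.pow_le_pow_left (by omega) 8
    omega
  have hnk16 : n ≤ k ^ 16 := by
    calc n ≤ (k + 1) ^ 8 := hnk.le
      _ ≤ (k ^ 2) ^ 8 := Nat.pow_le_pow_left (by nlinarith) 8
      _ = _ := by ring
  have hlt : n * k < k ^ 17 := by
    have : n < k ^ 16 := by
      calc n < (k + 1) ^ 8 := hnk
        _ ≤ (k ^ 2) ^ 8 := Nat.pow_le_pow_left (by nlinarith) 8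
        _ = _ := by ring
    calc n * k < k ^ 16 * k := Nat.mul_lt_mul_of_pos_right this (by omega)
      _ = k ^ 17 := by ring
  obtain ⟨P, hP, hPk⟩ := exists_sparse_independent_rows (by omega : 0 < k) hlt
  refine ⟨sandwichPMF P, ⟨k, ?_, ?_, isKUniform_sandwichPMF P hPk⟩, fun A hA => ?_⟩
  · calc (n : ℝ) ^ (1 / 16 : ℝ) ≤ ((k : ℝ) ^ 16) ^ (1 / 16 : ℝ) := by
          apply Real.rpow_le_rpow (by positivity) (by exact_mod_cast hnk16) (by norm_num)
      _ = k := by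
          rw [← Real.rpow_natCast, ← Real.rpow_mul (by positivity)]
          norm_num
  · exact (Nat.le_self_pow (by norm_num) k).trans hkn
  · have h := xorComplexity_le_of_mem_support_sandwichPMF hP hA
    have : 2 * (n * 17) + (17 * k ^ 4) ^ 2 ≤ 323 * n := by
      calc 2 * (n * 17) + (17 * k ^ 4) ^ 2 = 34 * n + 289 * k ^ 8 := by ring
        _ ≤ 34 * n + 289 * n := by gcongr
        _ = _ := by ring
    exact_mod_cast h.trans this

theorem exists_isPolyUniform_xorComplexity_le :
    ∃ μ : ∀ n : ℕ, PMF (Matrix (Fin n) (Fin n) Bool), IsPolyUniform μ ∧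
      ∃ C : ℝ, 0 < C ∧ ∀ᶠ n : ℕ in atTop, ∀ A ∈ (μ n).support, (xorComplexity A : ℝ) ≤ C * n := by
  classical
  have key : ∀ n : ℕ, ∃ μ : PMF (Matrix (Fin n) (Fin n) Bool), 256 ≤ n →
      (∃ k : ℕ, (n : ℝ) ^ (1 / 16 : ℝ) ≤ k ∧ k ≤ n ∧ IsKUniform μ k) ∧
      ∀ A ∈ μ.support, (xorComplexity A : ℝ) ≤ 323 * n := by
    intro n
    by_cases hn : 256 ≤ n
    · obtain ⟨μ, hμ⟩ := exists_isKUniform_xorComplexity_le hn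
      exact ⟨μ, fun _ => hμ⟩
    -- An arbitrary distribution; small `n` do not matter.
    · exact ⟨PMF.pure 0, fun h => absurd h hn⟩
  choose μ hμ using key
  refine ⟨μ, ⟨1 / 16, by norm_num, ?_⟩, 323, by norm_num, ?_⟩
  · filter_upwards [eventually_ge_atTop 256] with n hn using (hμ n hn).1
  · filter_upwards [eventually_ge_atTop 256] with n hn using (hμ n hn).2

/-! ### Uniform random matrices: no large all-ones submatrix -/

/-- A `Finset` of at most `k ≤ n` indices is contained in the range of an order embedding of
`Fin k`. -/
theorem exists_orderEmbedding_superset {n k : ℕ} (hk : k ≤ n) (S : Finset (Fin n))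
    (hS : S.card ≤ k) : ∃ e : Fin k ↪o Fin n, ∀ i ∈ S, ∃ a, e a = i := by
  obtain ⟨T, hST, -, hT⟩ := Finset.exists_subsuperset_card_eq (Finset.subset_univ S) hS
    (by simpa using hk)
  refine ⟨T.orderEmbOfFin hT, fun i hi => ?_⟩
  have : i ∈ Set.range (T.orderEmbOfFin hT) := by
    rw [Finset.range_orderEmbOfFin]
    exact hST hi
  exact this

theorem toOuterMeasure_uniform_all_true {α : Type*} [Fintype α] [DecidableEq α] (T : Finset α) :
    (PMF.uniformOfFintype (α → Bool)).toOuterMeasure {B | ∀ p ∈ T, B p = true} =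
      (2 ^ T.card : ENNReal)⁻¹ := by
  classical
  have hcard : Fintype.card {B : α → Bool | ∀ p ∈ T, B p = true} * 2 ^ T.card =
      2 ^ Fintype.card α := by
    have : Fintype.card {B : α → Bool | ∀ p ∈ T, B p = true} = 2 ^ (Fintype.card α - T.card) := by
      rw [← Set.toFinset_card]
      have : {B : α → Bool | ∀ p ∈ T, B p = true}.toFinset =
          Fintype.piFinset fun p => if p ∈ T then {true} else Finset.univ := by
        ext B
        simp only [Set.mem_toFinset, Set.mem_ofPred_eq, Fintype.mem_piFinset]
        refine forall_congr' fun p => ?_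
        by_cases hp : p ∈ T <;> simp [hp]
      rw [this, Fintype.card_piFinset]
      simp only [apply_ite Finset.card, Finset.card_singleton, Finset.card_univ, Fintype.card_bool]
      rw [Finset.prod_ite]
      simp [Finset.filter_not, Finset.card_sdiff]
    rw [this, ← pow_add, Nat.sub_add_cancel (Finset.card_le_univ T)]
  rw [PMF.toOuterMeasure_uniformOfFintype_apply, Fintype.card_fun, Fintype.card_bool, ← hcard]
  have hpos : Fintype.card {B : α → Bool | ∀ p ∈ T, B p = true} ≠ 0 := fun h => by
    rw [h, zero_mul] at hcard
    exact absurd hcard.symm (by positivity)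
  push_cast
  rw [ENNReal.div_eq_inv_mul, ENNReal.mul_inv (by simp) (by simp), mul_right_comm,
    ENNReal.inv_mul_cancel (by exact_mod_cast hpos) (by simp), one_mul]

/-- `S` and `T` extend to `k` rows and `k` columns, and in that submatrix the entries are
independent fair bits. -/
theorem IsKUniform.toOuterMeasure_all_true {n k : ℕ} {μ : PMF (Matrix (Fin n) (Fin n) Bool)}
    (h : IsKUniform μ k) (hkn : k ≤ n) (S T : Finset (Fin n)) (hS : S.card ≤ k) (hT : T.card ≤ k) :
    μ.toOuterMeasure {A | ∀ i ∈ S, ∀ j ∈ T, A i j = true} =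
      (2 ^ (S.card * T.card) : ENNReal)⁻¹ := by
  classical
  obtain ⟨r, hr⟩ := exists_orderEmbedding_superset hkn S hS
  obtain ⟨c, hc⟩ := exists_orderEmbedding_superset hkn T hT
  let S' : Finset (Fin k) := Finset.univ.filter fun a => r a ∈ S
  let T' : Finset (Fin k) := Finset.univ.filter fun a => c a ∈ T
  have hS' : S'.map r.toEmbedding = S := by
    ext i
    simp only [S', Finset.mem_map, Finset.mem_filter, Finset.mem_univ, true_and]
    constructor
    · rintro ⟨a, ha, rfl⟩
      exact ha
    · intro hi
      obtain ⟨a, rfl⟩ := hr i hi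
      exact ⟨a, hi, rfl⟩
  have hT' : T'.map c.toEmbedding = T := by
    ext i
    simp only [T', Finset.mem_map, Finset.mem_filter, Finset.mem_univ, true_and]
    constructor
    · rintro ⟨a, ha, rfl⟩
      exact ha
    · intro hi
      obtain ⟨a, rfl⟩ := hc i hi
      exact ⟨a, hi, rfl⟩
  let e : (Fin k × Fin k → Bool) ≃ Matrix (Fin k) (Fin k) Bool := Equiv.curry (Fin k) (Fin k) Bool
  have h1 : {A : Matrix (Fin n) (Fin n) Bool | ∀ i ∈ S, ∀ j ∈ T, A i j = true} =
      (fun A => A.submatrix r c) ⁻¹'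
        {B : Matrix (Fin k) (Fin k) Bool | ∀ i ∈ S', ∀ j ∈ T', B i j = true} := by
    ext A
    rw [← hS', ← hT']
    simp
  rw [h1, ← PMF.toOuterMeasure_map_apply, h r c, ← PMF.map_uniformOfFintype_equiv e,
    PMF.toOuterMeasure_map_apply]
  have h2 : (e ⁻¹'
      {B : Matrix (Fin k) (Fin k) Bool | ∀ i ∈ S', ∀ j ∈ T', B i j = true}) =
      {B | ∀ p ∈ S' ×ˢ T', B p = true} := by
    ext B
    simp only [Set.mem_preimage, Set.mem_ofPred_eq, Finset.mem_product, Prod.forall]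
    exact ⟨fun h a b hab => h a hab.1 b hab.2, fun h a ha b hb => h a b ⟨ha, hb⟩⟩
  rw [h2, toOuterMeasure_uniform_all_true, Finset.card_product, ← hS', ← hT', Finset.card_map,
    Finset.card_map]

/-- Union bound over the `r × r` submatrices. -/
theorem IsKUniform.toOuterMeasure_exists_all_true_le {n k r : ℕ}
    {μ : PMF (Matrix (Fin n) (Fin n) Bool)} (h : IsKUniform μ k) (hkn : k ≤ n) (hr : r ≤ k) :
    μ.toOuterMeasure {A | ∃ S T : Finset (Fin n), S.card = r ∧ T.card = r ∧
      ∀ i ∈ S, ∀ j ∈ T, A i j = true} ≤ (n : ENNReal) ^ (2 * r) * (2 ^ (r * r) : ENNReal)⁻¹ := by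
  classical
  let I : Finset (Finset (Fin n) × Finset (Fin n)) :=
    Finset.powersetCard r Finset.univ ×ˢ Finset.powersetCard r Finset.univ
  have hI : I.card ≤ n ^ (2 * r) := by
    rw [Finset.card_product, Finset.card_powersetCard, Finset.card_univ, Fintype.card_fin,
      two_mul, pow_add]
    exact Nat.mul_le_mul (Nat.choose_le_pow _ _) (Nat.choose_le_pow _ _)
  have hsub : {A : Matrix (Fin n) (Fin n) Bool | ∃ S T : Finset (Fin n), S.card = r ∧ T.card = r ∧
      ∀ i ∈ S, ∀ j ∈ T, A i j = true} ⊆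
      ⋃ p ∈ I, {A | ∀ i ∈ p.1, ∀ j ∈ p.2, A i j = true} := by
    rintro A ⟨S, T, hS, hT, hA⟩
    simp only [Set.mem_iUnion]
    exact ⟨(S, T), by simp [I, hS, hT], hA⟩
  calc _ ≤ μ.toOuterMeasure (⋃ p ∈ I, {A | ∀ i ∈ p.1, ∀ j ∈ p.2, A i j = true}) :=
        MeasureTheory.measure_mono hsub
    _ ≤ ∑ p ∈ I, μ.toOuterMeasure {A | ∀ i ∈ p.1, ∀ j ∈ p.2, A i j = true} :=
        MeasureTheory.measure_biUnion_finset_le _ _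
    _ = ∑ _p ∈ I, (2 ^ (r * r) : ENNReal)⁻¹ := by
        refine Finset.sum_congr rfl fun p hp => ?_
        simp only [I, Finset.mem_product, Finset.mem_powersetCard] at hp
        rw [h.toOuterMeasure_all_true hkn _ _ (hp.1.2.trans_le hr) (hp.2.2.trans_le hr), hp.1.2,
          hp.2.2]
    _ ≤ _ := by
        rw [Finset.sum_const, nsmul_eq_mul]
        gcongr
        exact_mod_cast hI

/-! ### Uniform random matrices: many ones -/

/-- The expectation of a real function under a distribution on a finite type. -/
noncomputable def PMF.expect {α : Type*} [Fintype α] (μ : PMF α) (f : α → ℝ) : ℝ :=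
  ∑ a, (μ a).toReal * f a

theorem PMF.expect_map {α β : Type*} [Fintype α] [Fintype β] (μ : PMF α) (g : α → β)
    (f : β → ℝ) : (μ.map g).expect f = μ.expect (f ∘ g) := by
  classical
  simp only [PMF.expect, PMF.map_apply, tsum_fintype, Function.comp_apply]
  have h : ∀ b, (∑ a, if b = g a then μ a else 0).toReal = ∑ a, if b = g a then (μ a).toReal
      else 0 := by
    intro b
    rw [ENNReal.toReal_sum]
    · exact Finset.sum_congr rfl fun a _ => by split <;> simp
    · intro a _
      split
      · exact μ.apply_ne_top a
      · simp
  simp only [h, Finset.sum_mul, ite_mul, zero_mul]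
  rw [Finset.sum_comm]
  simp

theorem PMF.expect_const {α : Type*} [Fintype α] (μ : PMF α) (c : ℝ) :
    μ.expect (fun _ => c) = c := by
  have h := congrArg ENNReal.toReal μ.tsum_coe
  rw [tsum_fintype, ENNReal.toReal_sum fun a _ => μ.apply_ne_top a, ENNReal.toReal_one] at h
  rw [PMF.expect, ← Finset.sum_mul, h, one_mul]

theorem PMF.expect_sum {α ι : Type*} [Fintype α] (μ : PMF α) (s : Finset ι) (f : ι → α → ℝ) :
    μ.expect (fun a => ∑ i ∈ s, f i a) = ∑ i ∈ s, μ.expect (f i) := by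
  simp only [PMF.expect, Finset.mul_sum]
  exact Finset.sum_comm

/-- Markov's inequality. -/
theorem PMF.toOuterMeasure_le_expect_div {α : Type*} [Fintype α] (μ : PMF α) {f : α → ℝ}
    (hf : ∀ a, 0 ≤ f a) {t : ℝ} (ht : 0 < t) {s : Set α} (hs : ∀ a ∈ s, t ≤ f a) :
    μ.toOuterMeasure s ≤ ENNReal.ofReal (μ.expect f / t) := by
  classical
  have hle : ∀ a, s.indicator μ a ≤ ENNReal.ofReal ((μ a).toReal * f a / t) := by
    intro a
    by_cases ha : a ∈ s
    · rw [Set.indicator_of_mem ha, ← ENNReal.ofReal_toReal (μ.apply_ne_top a)]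
      refine ENNReal.ofReal_le_ofReal ?_
      rw [ENNReal.toReal_ofReal ENNReal.toReal_nonneg, le_div_iff₀ ht]
      exact mul_le_mul_of_nonneg_left (hs a ha) ENNReal.toReal_nonneg
    · simp [Set.indicator_of_notMem ha]
  rw [PMF.toOuterMeasure_apply_fintype, PMF.expect, Finset.sum_div, ENNReal.ofReal_sum_of_nonneg
    fun a _ => div_nonneg (mul_nonneg ENNReal.toReal_nonneg (hf a)) ht.le]
  exact Finset.sum_le_sum fun a _ => hle a

/-- The bits as signs. -/
def boolSign (b : Bool) : ℝ := if b then 1 else -1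

theorem boolSign_not (b : Bool) : boolSign (!b) = -boolSign b := by
  cases b <;> simp [boolSign]

theorem boolSign_mul_self (b : Bool) : boolSign b * boolSign b = 1 := by
  cases b <;> simp [boolSign]

/-- Flipping the entry at `p` permutes the matrices and negates the product. -/
theorem expect_uniform_boolSign_mul {k : ℕ} {p q : Fin k × Fin k} (h : p ≠ q) :
    (PMF.uniformOfFintype (Matrix (Fin k) (Fin k) Bool)).expect
      (fun B => boolSign (B p.1 p.2) * boolSign (B q.1 q.2)) = 0 := by
  classical
  simp only [PMF.expect, PMF.uniformOfFintype_apply, ← Finset.mul_sum]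
  refine mul_eq_zero_of_right _ ?_
  let flip : Matrix (Fin k) (Fin k) Bool ≃ Matrix (Fin k) (Fin k) Bool :=
    Function.Involutive.toPerm (fun B i j => if (i, j) = p then !B i j else B i j) (fun B => by
      funext i j
      by_cases hij : (i, j) = p <;> simp [hij])
  have hflip : ∀ B, boolSign (flip B p.1 p.2) * boolSign (flip B q.1 q.2) =
      -(boolSign (B p.1 p.2) * boolSign (B q.1 q.2)) := by
    intro B
    have h1 : flip B p.1 p.2 = !B p.1 p.2 := if_pos rfl
    have h2 : flip B q.1 q.2 = B q.1 q.2 := if_neg (Ne.symm h)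
    rw [h1, h2, boolSign_not, neg_mul]
  have := flip.sum_comp fun B => boolSign (B p.1 p.2) * boolSign (B q.1 q.2)
  simp only [hflip, Finset.sum_neg_distrib] at this
  linarith

/-- For `k ≥ 2` any two entries lie in a common `k × k` submatrix. -/
theorem IsKUniform.expect_boolSign_mul {n k : ℕ} {μ : PMF (Matrix (Fin n) (Fin n) Bool)}
    (h : IsKUniform μ k) (hkn : k ≤ n) (hk : 2 ≤ k) {p q : Fin n × Fin n} (hpq : p ≠ q) :
    μ.expect (fun A => boolSign (A p.1 p.2) * boolSign (A q.1 q.2)) = 0 := by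
  classical
  obtain ⟨r, hr⟩ := exists_orderEmbedding_superset hkn {p.1, q.1} (Finset.card_le_two.trans hk)
  obtain ⟨c, hc⟩ := exists_orderEmbedding_superset hkn {p.2, q.2} (Finset.card_le_two.trans hk)
  obtain ⟨a, ha⟩ := hr p.1 (by simp)
  obtain ⟨a', ha'⟩ := hr q.1 (by simp)
  obtain ⟨b, hb⟩ := hc p.2 (by simp)
  obtain ⟨b', hb'⟩ := hc q.2 (by simp)
  have hne : (a, b) ≠ (a', b') := by
    intro hab
    rw [Prod.mk.injEq] at hab
    exact hpq (Prod.ext (by rw [← ha, ← ha', hab.1]) (by rw [← hb, ← hb', hab.2]))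
  have := expect_uniform_boolSign_mul hne
  rw [← h r c, PMF.expect_map] at this
  rw [← this, ← ha, ← ha', ← hb, ← hb']
  rfl

theorem IsKUniform.expect_sq_sum_boolSign {n k : ℕ} {μ : PMF (Matrix (Fin n) (Fin n) Bool)}
    (h : IsKUniform μ k) (hkn : k ≤ n) (hk : 2 ≤ k) :
    μ.expect (fun A => (∑ p : Fin n × Fin n, boolSign (A p.1 p.2)) ^ 2) = (n : ℝ) ^ 2 := by
  classical
  simp only [sq, Finset.sum_mul_sum, PMF.expect_sum]
  have : ∀ p q : Fin n × Fin n, μ.expect (fun A => boolSign (A p.1 p.2) * boolSign (A q.1 q.2)) =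
      if p = q then 1 else 0 := by
    intro p q
    by_cases hpq : p = q
    · simp only [hpq, boolSign_mul_self, PMF.expect_const, if_true]
    · rw [if_neg hpq, h.expect_boolSign_mul hkn hk hpq]
  simp [this]

theorem sum_boolSign {ι : Type*} [Fintype ι] (f : ι → Bool) :
    ∑ p, boolSign (f p) = 2 * ((Finset.univ.filter fun p => f p = true).card : ℝ) -
      Fintype.card ι := by
  have : ∀ b, boolSign b = 2 * (if b = true then 1 else 0) - 1 := by
    intro b
    cases b <;> norm_num [boolSign]
  simp only [this, Finset.sum_sub_distrib, ← Finset.mul_sum, Finset.card_filter]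
  simp

/-- Chebyshev's inequality for the number of ones. -/
theorem IsKUniform.toOuterMeasure_card_ones_lt_le {n k : ℕ}
    {μ : PMF (Matrix (Fin n) (Fin n) Bool)} (h : IsKUniform μ k) (hkn : k ≤ n) (hk : 2 ≤ k) :
    μ.toOuterMeasure {A | ((Finset.univ.filter fun p : Fin n × Fin n => A p.1 p.2 = true).card : ℝ)
      < (n : ℝ) ^ 2 / 4} ≤ ENNReal.ofReal (4 / (n : ℝ) ^ 2) := by
  have hn : (0 : ℝ) < n := by exact_mod_cast (by omega : 0 < n)
  have := μ.toOuterMeasure_le_expect_div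
    (f := fun A => (∑ p : Fin n × Fin n, boolSign (A p.1 p.2)) ^ 2) (fun A => sq_nonneg _)
    (t := ((n : ℝ) ^ 2 / 2) ^ 2) (by positivity)
    (s := {A | ((Finset.univ.filter fun p : Fin n × Fin n => A p.1 p.2 = true).card : ℝ)
      < (n : ℝ) ^ 2 / 4}) ?_
  · rw [h.expect_sq_sum_boolSign hkn hk] at this
    refine this.trans (ENNReal.ofReal_le_ofReal (le_of_eq ?_))
    field_simp
    norm_num
  · intro A hA
    rw [Set.mem_ofPred_eq] at hA
    -- The signs sum to twice the number of ones minus `n²`, which is below `-n²/2` here.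
    rw [sum_boolSign fun p : Fin n × Fin n => A p.1 p.2, Fintype.card_prod, Fintype.card_fin]
    push_cast
    rw [← sq_abs (2 * _ - _)]
    refine pow_le_pow_left₀ (by positivity) ?_ 2
    rw [le_abs]
    right
    linarith

/-! ### Lower bounds with high probability and the gaps. -/

theorem div_logb_sq_le_orComplexity {n r : ℕ} {A : Matrix (Fin n) (Fin n) Bool} (hr : 2 ≤ r)
    (hrn : (r : ℝ) ≤ 6 * Real.logb 2 n) (hlog : 6 * Real.logb 2 n ≤ n / 8)
    (hfree : ¬ ∃ S T : Finset (Fin n), S.card = r ∧ T.card = r ∧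
      ∀ i ∈ S, ∀ j ∈ T, A i j = true)
    (hones : (n : ℝ) ^ 2 / 4 ≤
      ((Finset.univ.filter fun p : Fin n × Fin n => A p.1 p.2 = true).card : ℝ)) :
    1 / 288 * ((n : ℝ) ^ 2 / Real.logb 2 n ^ 2) ≤ orComplexity A := by
  have h := card_ones_le_mul_orComplexity (A := A) hr fun S T hS hT => by
    by_contra! hcon
    exact hfree ⟨S, T, hS, hT, fun i hi j hj => by simpa using hcon i hi j hj⟩
  have h' : (n : ℝ) ^ 2 / 4 ≤ (r : ℝ) ^ 2 * orComplexity A + n * r :=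
    hones.trans (by exact_mod_cast h)
  have hr2 : (2 : ℝ) ≤ r := by exact_mod_cast hr
  have hpos : 0 < Real.logb 2 n := by linarith
  -- The term `n r` absorbs at most half of the `n²/4` ones; the remaining `n²/8` against `r² ≤ 36
  -- log² n` gives `1/288`.
  have hnr : (n : ℝ) * r ≤ n ^ 2 / 8 := by
    calc (n : ℝ) * r ≤ n * (n / 8) := by gcongr; linarith
      _ = _ := by ring
  have hsq : (r : ℝ) ^ 2 * orComplexity A ≤ (6 * Real.logb 2 n) ^ 2 * orComplexity A := by gcongr
  rw [← mul_div_assoc, div_le_iff₀ (by positivity)]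
  linarith

theorem eventually_le_toOuterMeasure {δ : ℝ} (hδ : 0 < δ) :
    ∀ᶠ n : ℕ in atTop, ∀ (k : ℕ) (μ : PMF (Matrix (Fin n) (Fin n) Bool)), (n : ℝ) ^ δ ≤ k →
      k ≤ n → IsKUniform μ k →
      1 - (ENNReal.ofReal (1 / n) + ENNReal.ofReal (4 / (n : ℝ) ^ 2)) ≤ μ.toOuterMeasure
        {A | 1 / 288 * ((n : ℝ) ^ 2 / Real.logb 2 n ^ 2) ≤ (orComplexity A : ℝ) ∧
          1 / 288 * ((n : ℝ) ^ 2 / Real.logb 2 n ^ 2) ≤ (sumComplexity A : ℝ)} := by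
  have hlog2 : 0 < Real.log 2 := Real.log_pos one_lt_two
  have hsmall : ∀ ε : ℝ, 0 < ε → ∀ c : ℝ, 0 < c →
      ∀ᶠ n : ℕ in atTop, 6 * Real.logb 2 n ≤ c * (n : ℝ) ^ ε := by
    intro ε hε c hc
    have := tendsto_natCast_atTop_atTop.eventually
      ((isLittleO_log_rpow_atTop hε).bound (show 0 < c * Real.log 2 / 6 by positivity))
    filter_upwards [this] with n hn
    have h2 : Real.log n ≤ c * Real.log 2 / 6 * (n : ℝ) ^ ε := by
      rw [Real.norm_of_nonneg (by positivity : (0 : ℝ) ≤ (n : ℝ) ^ ε)] at hn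
      exact (Real.le_norm_self _).trans hn
    rw [Real.logb, ← mul_div_assoc, div_le_iff₀ hlog2]
    linarith
  filter_upwards [hsmall δ hδ 1 one_pos, hsmall 1 one_pos (1 / 8) (by norm_num),
    eventually_ge_atTop 2] with n h1 h2 hn k μ hk hkn hμ
  rw [one_mul] at h1
  rw [Real.rpow_one] at h2
  have hn0 : 0 < n := by omega
  have hnR : (0 : ℝ) < n := by exact_mod_cast hn0
  have hlog1 : 1 ≤ Real.logb 2 n := by
    rw [Real.le_logb_iff_rpow_le one_lt_two hnR, Real.rpow_one]
    exact_mod_cast hn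
  -- The forbidden submatrices have side `r = 3L`. As `n ≤ 2^L`, the union bound is at most `2^(6L²
  -- - 9L²) ≤ 2^(-L) ≤ 1/n`; and `r ≤ 6 log n ≤ n^δ ≤ k` keeps these submatrices within reach of
  -- uniformity.
  set L := Nat.log 2 n + 1 with hL
  have hnL : n ≤ 2 ^ L := (Nat.lt_pow_succ_log_self one_lt_two n).le
  have hrlog : ((3 * L : ℕ) : ℝ) ≤ 6 * Real.logb 2 n := by
    have : (Nat.log 2 n : ℝ) ≤ Real.logb 2 n := by
      rw [Real.le_logb_iff_rpow_le one_lt_two hnR, Real.rpow_natCast]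
      exact_mod_cast Nat.pow_log_le_self 2 hn0.ne'
    push_cast [hL]
    linarith
  have hrk : 3 * L ≤ k := by exact_mod_cast hrlog.trans (h1.trans hk)
  have hbad1 := hμ.toOuterMeasure_exists_all_true_le hkn hrk
  have hbad2 := hμ.toOuterMeasure_card_ones_lt_le hkn (by omega)
  have htail : (n : ENNReal) ^ (2 * (3 * L)) * (2 ^ (3 * L * (3 * L)) : ENNReal)⁻¹ ≤
      ENNReal.ofReal (1 / n) := by
    have hnat : n * n ^ (2 * (3 * L)) ≤ 2 ^ (3 * L * (3 * L)) := by
      calc n * n ^ (2 * (3 * L)) ≤ 2 ^ L * (2 ^ L) ^ (2 * (3 * L)) := by gcongr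
        _ = 2 ^ (L + L * (2 * (3 * L))) := by rw [← pow_mul, ← pow_add]
        _ ≤ 2 ^ (3 * L * (3 * L)) := Nat.pow_le_pow_right two_pos (by nlinarith)
    rw [one_div, ENNReal.ofReal_inv_of_pos hnR, ENNReal.ofReal_natCast, ← div_eq_mul_inv]
    refine ENNReal.div_le_of_le_mul ?_
    rw [mul_comm (n : ENNReal)⁻¹, ← div_eq_mul_inv, ENNReal.le_div_iff_mul_le (by simp [hn0.ne']) (by simp),
      mul_comm]
    exact_mod_cast hnat
  -- The good event and the two bad ones cover the whole support, so their measures add up to at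
  -- least `1`.
  rw [tsub_le_iff_right]
  refine le_trans ?_ (add_le_add_right (add_le_add (hbad1.trans htail) hbad2) _)
  refine le_trans ?_ (add_le_add_right (MeasureTheory.measure_union_le _ _) _)
  refine le_trans ?_ (MeasureTheory.measure_union_le _ _)
  refine ((PMF.toOuterMeasure_apply_eq_one_iff _ _).2 fun A _ => ?_).ge
  by_contra hA
  simp only [Set.mem_union, Set.mem_ofPred_eq, not_or, not_lt] at hA
  have hor := div_logb_sq_le_orComplexity (by omega) hrlog (by linarith) hA.2.1 hA.2.2
  exact hA.1 ⟨hor, hor.trans (by exact_mod_cast orComplexity_le_sumComplexity A)⟩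

theorem IsPolyUniform.tendsto_toOuterMeasure {μ : ∀ n : ℕ, PMF (Matrix (Fin n) (Fin n) Bool)}
    (hμ : IsPolyUniform μ) :
    Tendsto (fun n : ℕ => (μ n).toOuterMeasure
      {A | 1 / 288 * ((n : ℝ) ^ 2 / Real.logb 2 n ^ 2) ≤ (orComplexity A : ℝ) ∧
        1 / 288 * ((n : ℝ) ^ 2 / Real.logb 2 n ^ 2) ≤ (sumComplexity A : ℝ)}) atTop (𝓝 1) := by
  obtain ⟨δ, hδ, h⟩ := hμ
  have hlim : Tendsto (fun n : ℕ => (1 : ENNReal) -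
      (ENNReal.ofReal (1 / n) + ENNReal.ofReal (4 / (n : ℝ) ^ 2))) atTop (𝓝 1) := by
    have t1 : Tendsto (fun n : ℕ => ENNReal.ofReal (1 / n)) atTop (𝓝 0) := by
      simpa using ENNReal.tendsto_ofReal tendsto_one_div_atTop_nhds_zero_nat
    have t2 : Tendsto (fun n : ℕ => ENNReal.ofReal (4 / (n : ℝ) ^ 2)) atTop (𝓝 0) := by
      have : Tendsto (fun n : ℕ => 4 / (n : ℝ) ^ 2) atTop (𝓝 0) :=
        tendsto_const_nhds.div_atTop
          ((tendsto_pow_atTop two_ne_zero).comp tendsto_natCast_atTop_atTop)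
      simpa using ENNReal.tendsto_ofReal this
    simpa using ENNReal.Tendsto.sub tendsto_const_nhds (t1.add t2) (Or.inl ENNReal.one_ne_top)
  refine tendsto_of_tendsto_of_tendsto_of_le_of_le' hlim tendsto_const_nhds ?_ ?_
  · filter_upwards [h, eventually_le_toOuterMeasure hδ] with n ⟨k, hk, hkn, hu⟩ hn
    exact hn k (μ n) hk hkn hu
  · refine Eventually.of_forall fun n => ?_
    refine (MeasureTheory.measure_mono (Set.subset_univ _)).trans (le_of_eq ?_)
    exact (PMF.toOuterMeasure_apply_eq_one_iff _ _).2 (Set.subset_univ _)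

/-- Matrices of small XOR-complexity and large OR-complexity separate XOR-circuits from circuits
over any semiring that are at least as large as OR-circuits. -/
theorem exists_le_complexityGap (R : Type) [CommSemiring R]
    (hR : ∀ (n : ℕ) (A : Matrix (Fin n) (Fin n) Bool), orComplexity A ≤ circuitComplexity R A) :
    ∃ c : ℝ, 0 < c ∧ ∀ᶠ n : ℕ in atTop,
      c * ((n : ℝ) / Real.logb 2 n ^ 2) ≤ complexityGap R (ZMod 2) n := by
  obtain ⟨μ, hμ, C, hC, hxor⟩ := exists_isPolyUniform_xorComplexity_le
  refine ⟨1 / 288 / C, by positivity, ?_⟩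
  filter_upwards [hxor, hμ.tendsto_toOuterMeasure.eventually_ne one_ne_zero,
    eventually_ge_atTop 2] with n hn hne hn2
  -- Positive measure puts an outcome of the support, whose XOR-complexity is linear, into the event
  -- of large OR-complexity.
  rw [Ne, PMF.toOuterMeasure_apply_eq_zero_iff, Set.not_disjoint_iff] at hne
  obtain ⟨A, hA, hor, -⟩ := hne
  have hnR : (0 : ℝ) < n := by exact_mod_cast (by omega : 0 < n)
  have hlog : 0 < Real.logb 2 n := Real.logb_pos one_lt_two (by exact_mod_cast hn2)
  have hRA : 1 / 288 * ((n : ℝ) ^ 2 / Real.logb 2 n ^ 2) ≤ circuitComplexity R A :=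
    hor.trans (by exact_mod_cast hR n A)
  -- Division by zero yields `0`, so the ratio is informative only once its denominator is known to
  -- be positive.
  have hxpos : (0 : ℝ) < circuitComplexity (ZMod 2) A := by
    rw [Nat.cast_pos, Nat.pos_iff_ne_zero]
    intro h0
    rw [circuitComplexity_eq_zero_of_eq_zero R (ZMod 2) h0, Nat.cast_zero] at hRA
    exact absurd hRA (not_le.2 (by positivity))
  refine le_trans ?_ (Finset.le_sup' (fun A : Matrix (Fin n) (Fin n) Bool =>
    (circuitComplexity R A : ℝ) / (circuitComplexity (ZMod 2) A : ℝ)) (Finset.mem_univ A))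
  calc 1 / 288 / C * ((n : ℝ) / Real.logb 2 n ^ 2)
      = 1 / 288 * ((n : ℝ) ^ 2 / Real.logb 2 n ^ 2) / (C * n) := by field_simp
    _ ≤ circuitComplexity R A / (C * n) := by gcongr
    _ ≤ _ := by
      gcongr
      exact hn A hA

theorem corollary3 :
    -- both gaps are `Ω(n / log² n)`
    (∃ c : ℝ, 0 < c ∧ ∀ᶠ n : ℕ in atTop,
      c * ((n : ℝ) / Real.logb 2 n ^ 2) ≤ complexityGap BoolSemiring (ZMod 2) n) ∧
    (∃ c : ℝ, 0 < c ∧ ∀ᶠ n : ℕ in atTop,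
      c * ((n : ℝ) / Real.logb 2 n ^ 2) ≤ complexityGap ℕ (ZMod 2) n) ∧
    -- there are `n^{Ω(1)}`-uniform matrices of linear XOR-complexity
    (∃ μ : ∀ n : ℕ, PMF (Matrix (Fin n) (Fin n) Bool), IsPolyUniform μ ∧
      ∃ C : ℝ, 0 < C ∧ ∀ᶠ n : ℕ in atTop, ∀ A ∈ (μ n).support,
        (xorComplexity A : ℝ) ≤ C * n) ∧
    -- `n^{Ω(1)}`-uniform matrices need OR- and SUM-circuits of size `Ω(n² / log² n)` w.h.p.
    (∃ c : ℝ, 0 < c ∧ ∀ μ : ∀ n : ℕ, PMF (Matrix (Fin n) (Fin n) Bool), IsPolyUniform μ →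
      Tendsto (fun n : ℕ => (μ n).toOuterMeasure
        {A | c * ((n : ℝ) ^ 2 / Real.logb 2 n ^ 2) ≤ (orComplexity A : ℝ) ∧
          c * ((n : ℝ) ^ 2 / Real.logb 2 n ^ 2) ≤ (sumComplexity A : ℝ)}) atTop (𝓝 1)) := by

  exact ⟨exists_le_complexityGap BoolSemiring fun _ _ => le_rfl,
    exists_le_complexityGap ℕ fun _ A => orComplexity_le_sumComplexity A,
    exists_isPolyUniform_xorComplexity_le,
    1 / 288, by norm_num, fun _ hμ => hμ.tendsto_toOuterMeasure⟩
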